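/- **Theorem (total complexity of IAPG).** Let $f:\mathbb R^n\to\mathbb R$ be convex, differentiable and $L$-Lipschitz smooth, i.e. $D_f(x,y):=f(x)-f(y)-\langle\nabla f(y),x-y\rangle\le\frac L2\|x-y\|^2$ for all $x,y$. Let $\omega:\mathbb R^m\to\mathbb R$ be convex and $K_\omega$-Lipschitz, $A\in\mathbb R^{m\times n}$, $g(x)=\omega(Ax)$, $F=f+g$, and let $\bar x$ be a minimizer of $F$. For a function $\varphi$ and $\epsilon\ge 0$ write $\partial_\epsilon\varphi(x)=\{v:\langle v,z-x\rangle\le\varphi(z)-\varphi(x)+\epsilon\ \forall z\}$. *Outer loop.* Let $\alpha_k\in(0,1]$, $B_k>0$, $\rho_k\ge0$, $\epsilon_k>0$, $L_k:=B_k+\rho_k$, and let $x_{-1},x_{-1}^\circ\in\mathbb R^n$ be arbitrary. For all $k\ge0$ let $$y_k=\alpha_kx_{k-1}^\circ+(1-\alpha_k)x_{k-1},\qquad L_k(y_k-x_k)-\nabla f(y_k)\in\partial_{\epsilon_k}g(x_k),$$ $$D_f(x_k,y_k)\le\tfrac{B_k}2\|x_k-y_k\|^2,\qquad x_k^\circ=x_{k-1}+\alpha_k^{-1}(x_k-x_{k-1}).$$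 Suppose that $\alpha_0=1$ and $1-\alpha_k=\frac{\alpha_k^2L_k}{\alpha_{k-1}^2L_{k-1}}$ for $k\ge1$, that $0<L_{\min}\le L_k\le L_{\max}$ for all $k$, and, for some $\mathcal E_0>0$ and $p>1$, that $\epsilon_0=\mathcal E_0$ and $\epsilon_k=\frac{\mathcal E_0\beta_k}{k^p}+\frac{\rho_k}2\|x_k-y_k\|^2$ for $k\ge1$, where $\beta_k=\prod_{i=1}^k\max\bigl(1-\alpha_i,\frac{\alpha_i^2L_i}{\alpha_{i-1}^2L_{i-1}}\bigr)$. *Inner loops.* For $k\ge0$ put $\lambda_k=L_k^{-1}$, $\tilde y_k=y_k-L_k^{-1}\nabla f(y_k)$, $h_k(u)=\frac1{2\lambda_k}\|\lambda_ku-\tilde y_k\|^2-\frac1{2\lambda_k}\|\tilde y_k\|^2$, $\Phi_k(u)=\omega(Au)+\frac1{2\lambda_k}\|u-\tilde y_k\|^2$ and $\Psi_k(v)=h_k(A^\top v)+\omega^\star(v)$, where $\omega^\star$ is the Fenchel conjugate. Suppose that $\Psi_k$ has a minimizer and satisfies quadratic growth with a constant $\kappa_k\ge\kappa_{\min}>0$: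 $\Psi_k(v)\ge\min\Psi_k+\frac{\kappa_k}2\operatorname{dist}(v\,|\,\operatorname{argmin}\Psi_k)^2$ for all $v$. Let $v_0^{(k)}\in\operatorname{dom}\omega^\star$ and for $j\ge0$, with line search constants $0<\tau_j^{(k)}\le\bar\tau_{\max}$, $$v_{j+1}^{(k)}=\operatorname{prox}_{(1/\tau_j^{(k)})\omega^\star}\Bigl(v_j^{(k)}-\tfrac1{\tau_j^{(k)}}A\nabla h_k(A^\top v_j^{(k)})\Bigr),\qquad D_{h_k\circ A^\top}(v_{j+1}^{(k)},v_j^{(k)})\le\tfrac{\tau_j^{(k)}}2\|v_{j+1}^{(k)}-v_j^{(k)}\|^2,$$ and $z_j^{(k)}=\tilde y_k-\lambda_kA^\top v_j^{(k)}$ for all $j\ge0$. The $k$-th inner loop stops at the least index $J_k\ge0$ with $\Phi_k(z_{J_k}^{(k)})+\Psi_k(v_{J_k}^{(k)})\le\epsilon_k$. Ignoring line search, outer iteration $k$ calls $\nabla f$ once, and each of its $J_k$ inner iterations calls the proximal operator of (a multiple of) $\omega^\star$ once. Let $N_k=\sum_{l=0}^k(1+J_l)$ be the total number of calls made in outer iterations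 $0,\dots,k$. Then every inner loop stops (each $J_k$ exists and is finite), and there are $C>0$ and $\varepsilon_0>0$, depending only on $L$, $L_{\min}$, $L_{\max}$, $p$, $\mathcal E_0$, $\kappa_{\min}$, $\bar\tau_{\max}$, $K_\omega$ and on upper bounds for $\|A\|$ and $\|\bar x-x_{-1}^\circ\|$, such that for every $\varepsilon\in(0,\varepsilon_0]$: 1. there is $k\ge0$ with $F(x_k)-F(\bar x)\le\varepsilon$ and $N_k\le C\,\varepsilon^{-1/2}\ln(\varepsilon^{-1})$; 2. there is $k\ge0$ with $\partial_{\epsilon_k}F(x_k)\neq\emptyset$, $\operatorname{dist}(\mathbf 0\,|\,\partial_{\epsilon_k}F(x_k))\le\varepsilon$ and $N_k\le C\,\varepsilon^{-1}\ln(\varepsilon^{-1})$. -/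

import Mathlib

open scoped Gradient RealInnerProductSpace NNReal

noncomputable section

namespace IAPG

/-- The Euclidean space of dimension `n`. -/
abbrev E (n : ℕ) : Type := EuclideanSpace ℝ (Fin n)

/-! ### Convex analysis -/

/-- Bregman divergence `D_φ(x, y) = φ x - φ y - ⟨∇φ y, x - y⟩`. -/
def bregman {n : ℕ} (φ : E n → ℝ) (x y : E n) : ℝ :=
  φ x - φ y - ⟪∇ φ y, x - y⟫

/-- `f` is convex, differentiable and `L`-Lipschitz smooth. -/
structure IsConvexSmooth {n : ℕ} (f : E n → ℝ) (L : ℝ) : Prop where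
  convex : ConvexOn ℝ Set.univ f
  differentiable : Differentiable ℝ f
  bregman_le : ∀ x y, bregman f x y ≤ L / 2 * ‖x - y‖ ^ 2

/-- The `ε`-subdifferential at `x₀` of a finite-valued function. -/
def epsSubdiff {n : ℕ} (g : E n → ℝ) (ε : ℝ) (x₀ : E n) : Set (E n) :=
  {v | ∀ x, ⟪v, x - x₀⟫ ≤ g x - g x₀ + ε}

/-- `x' ≈_ε T_r(x)`, that is `0 ∈ ∇f(x) - r (x - x') + ∂_ε g(x')`. -/
def IsInexactProxGrad {n : ℕ} (f g : E n → ℝ) (r ε : ℝ) (x x' : E n) : Prop :=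
  r • (x - x') - ∇ f x ∈ epsSubdiff g ε x'

/-- Fenchel conjugate `g⋆(x) = sup_z (⟨z, x⟩ - g z)`. -/
def conjugate {m : ℕ} (g : E m → EReal) (x : E m) : EReal :=
  ⨆ z : E m, ((⟪z, x⟫ : ℝ) : EReal) - g z

/-- The conjugate `ω⋆` of a finite-valued function `ω`. -/
def conj {m : ℕ} (ω : E m → ℝ) : E m → EReal :=
  conjugate fun z => (ω z : EReal)

/-- The set of global minimizers. -/
def argmin {m : ℕ} (φ : E m → EReal) : Set (E m) :=
  {x | ∀ z, φ x ≤ φ z}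

/-- `prox_{t φ}(x) = argmin_z (φ z + ‖x - z‖² / (2t))`, as a set of minimizers (a singleton when
`φ` is proper, closed and convex and `t > 0`). -/
def prox {m : ℕ} (t : ℝ) (φ : E m → EReal) (x : E m) : Set (E m) :=
  argmin fun z => φ z + ((1 / (2 * t) * ‖x - z‖ ^ 2 : ℝ) : EReal)

/-- Quadratic growth with constant `κ > 0` of a function that has a minimizer. -/
structure HasQuadraticGrowth {m : ℕ} (Ψ : E m → EReal) (κ : ℝ) : Prop where
  pos : 0 < κ
  nonempty : (argmin Ψ).Nonempty
  growth : ∀ x, (⨅ z, Ψ z) + ((κ / 2 * Metric.infDist x (argmin Ψ) ^ 2 : ℝ) : EReal) ≤ Ψ x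

/-! ### The proximal subproblem, its dual, and the inner loop -/

/-- `h_t(u) = ‖t u - y‖² / (2t) - ‖y‖² / (2t)`. -/
def hQuad {n : ℕ} (t : ℝ) (y u : E n) : ℝ :=
  1 / (2 * t) * ‖t • u - y‖ ^ 2 - 1 / (2 * t) * ‖y‖ ^ 2

/-- Smooth part `v ↦ h_t(Aᵀ v)` of the dual objective. -/
def dualSmooth {n m : ℕ} (A : E n →L[ℝ] E m) (t : ℝ) (y : E n) (v : E m) : ℝ :=
  hQuad t y (A.adjoint v)

/-- Primal objective `Φ_t(u) = ω(A u) + ‖u - y‖² / (2t)`. -/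
def primal {n m : ℕ} (ω : E m → ℝ) (A : E n →L[ℝ] E m) (t : ℝ) (y u : E n) : ℝ :=
  ω (A u) + 1 / (2 * t) * ‖u - y‖ ^ 2

/-- Dual objective `Ψ_t(v) = h_t(Aᵀ v) + ω⋆(v)`. -/
def dual {n m : ℕ} (ω : E m → ℝ) (A : E n →L[ℝ] E m) (t : ℝ) (y : E n) (v : E m) : EReal :=
  (dualSmooth A t y v : EReal) + conj ω v

/-- Duality gap `G_t(u, v) = Φ_t(u) + Ψ_t(v)`. -/
def gap {n m : ℕ} (ω : E m → ℝ) (A : E n →L[ℝ] E m) (t : ℝ) (y u : E n) (v : E m) : EReal :=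
  (primal ω A t y u : EReal) + dual ω A t y v

/-- The primal point `z = y - t Aᵀ v` attached to the dual point `v`. -/
def primalPoint {n m : ℕ} (A : E n →L[ℝ] E m) (t : ℝ) (y : E n) (v : E m) : E n :=
  y - t • A.adjoint v

/-- The point `v - τ⁻¹ A ∇h_t(Aᵀ v)` at which an inner iteration calls the proximal operator. -/
def innerQuery {n m : ℕ} (A : E n →L[ℝ] E m) (t : ℝ) (y : E n) (τ : ℝ) (v : E m) : E m :=
  v - τ⁻¹ • A (∇ (hQuad t y) (A.adjoint v))

/-- `v 0, v 1, …` are proximal gradient iterates for the dual `Ψ_t`, started at a point of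
`dom ω⋆`, with accepted line search constants `τ j` bounded by `τbar`. -/
structure IsInnerRun {n m : ℕ} (ω : E m → ℝ) (A : E n →L[ℝ] E m) (t : ℝ) (y : E n)
    (τbar : ℝ) (τ : ℕ → ℝ) (v : ℕ → E m) : Prop where
  feasible : conj ω (v 0) < ⊤
  tau_pos : ∀ j, 0 < τ j
  tau_le : ∀ j, τ j ≤ τbar
  step : ∀ j, v (j + 1) ∈ prox (τ j)⁻¹ (conj ω) (innerQuery A t y (τ j) (v j))
  line_search : ∀ j,
    bregman (dualSmooth A t y) (v (j + 1)) (v j) ≤ τ j / 2 * ‖v (j + 1) - v j‖ ^ 2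

/-! ### The outer loop -/

/-- The parameters and iterates of the outer loop; `xInit`, `xcInit` are the iterates
`x_{-1}`, `x°_{-1}` and `xc k` is `x°_k`. -/
structure OuterLoop (n : ℕ) where
  α : ℕ → ℝ
  B : ℕ → ℝ
  ρ : ℕ → ℝ
  ε : ℕ → ℝ
  xInit : E n
  xcInit : E n
  x : ℕ → E n
  y : ℕ → E n
  xc : ℕ → E n

/-- `L_k = B_k + ρ_k`. -/
def OuterLoop.Lk {n : ℕ} (s : OuterLoop n) (k : ℕ) : ℝ := s.B k + s.ρ k

/-- `x_{k-1}`. -/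
def OuterLoop.xPrev {n : ℕ} (s : OuterLoop n) : ℕ → E n
  | 0 => s.xInit
  | k + 1 => s.x k

/-- `x°_{k-1}`. -/
def OuterLoop.xcPrev {n : ℕ} (s : OuterLoop n) : ℕ → E n
  | 0 => s.xcInit
  | k + 1 => s.xc k

/-- `β_k = ∏_{i=1}^k max(1 - α_i, α_i² L_i / (α_{i-1}² L_{i-1}))`, with `β_0 = 1`. -/
def OuterLoop.β {n : ℕ} (s : OuterLoop n) (k : ℕ) : ℝ :=
  ∏ i ∈ Finset.range k,
    max (1 - s.α (i + 1)) (s.α (i + 1) ^ 2 * s.Lk (i + 1) / (s.α i ^ 2 * s.Lk i))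

/-- The inexact accelerated proximal gradient iteration for `f + g`. -/
structure OuterLoop.IsRun {n : ℕ} (s : OuterLoop n) (f g : E n → ℝ) : Prop where
  alpha_mem : ∀ k, s.α k ∈ Set.Ioc (0 : ℝ) 1
  B_pos : ∀ k, 0 < s.B k
  rho_nonneg : ∀ k, 0 ≤ s.ρ k
  eps_pos : ∀ k, 0 < s.ε k
  y_eq : ∀ k, s.y k = s.α k • s.xcPrev k + (1 - s.α k) • s.xPrev k
  x_step : ∀ k, IsInexactProxGrad f g (s.Lk k) (s.ε k) (s.y k) (s.x k)
  line_search : ∀ k, bregman f (s.x k) (s.y k) ≤ s.B k / 2 * ‖s.x k - s.y k‖ ^ 2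
  xc_eq : ∀ k, s.xc k = s.xPrev k + (s.α k)⁻¹ • (s.x k - s.xPrev k)

/-- The optimal momentum sequence, bounds on `L_k`, and the largest valid error schedule. -/
structure OuterLoop.IsOptimal {n : ℕ} (s : OuterLoop n) (Lmin Lmax p E₀ : ℝ) : Prop where
  alpha_zero : s.α 0 = 1
  alpha_succ : ∀ k,
    1 - s.α (k + 1) = s.α (k + 1) ^ 2 * s.Lk (k + 1) / (s.α k ^ 2 * s.Lk k)
  Lk_mem : ∀ k, s.Lk k ∈ Set.Icc Lmin Lmax
  eps_zero : s.ε 0 = E₀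
  eps_eq : ∀ k : ℕ, 1 ≤ k →
    s.ε k = E₀ * s.β k / (k : ℝ) ^ p + s.ρ k * (‖s.x k - s.y k‖ ^ 2 / 2)

/-- Step size `λ⁽ᵏ⁾ = 1 / L_k` of the `k`-th proximal subproblem. -/
def OuterLoop.lam {n : ℕ} (s : OuterLoop n) (k : ℕ) : ℝ := (s.Lk k)⁻¹

/-- Centre `y_k - ∇f(y_k) / L_k` of the `k`-th proximal subproblem. -/
def OuterLoop.yTilde {n : ℕ} (s : OuterLoop n) (f : E n → ℝ) (k : ℕ) : E n :=
  s.y k - (s.Lk k)⁻¹ • ∇ f (s.y k)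

/-! ### All inner loops together, and the calls to the oracles -/

/-- For every outer iteration `k`: the dual iterates `v k j`, the accepted line search constants
`τ k j`, a bound `τbar k` for them, and a quadratic growth constant `κ k`. -/
structure InnerLoops (m : ℕ) where
  v : ℕ → ℕ → E m
  τ : ℕ → ℕ → ℝ
  τbar : ℕ → ℝ
  κ : ℕ → ℝ

/-- The globally bounded inner loops attached to the outer loop `s`: the `k`-th one works on the
proximal subproblem that `x k` solves inexactly, with the same tolerance `ε k` (see `stopSet`). The
outer iterate `x k` may be the point that this inner loop returns, but any `ε k`-inexact proximal
gradient point is allowed. -/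
structure InnerLoops.IsRun {n m : ℕ} (r : InnerLoops m) (s : OuterLoop n) (f : E n → ℝ) (ω : E m → ℝ)
    (A : E n →L[ℝ] E m) (κmin τmax : ℝ) : Prop where
  run : ∀ k, IsInnerRun ω A (s.lam k) (s.yTilde f k) (r.τbar k) (r.τ k) (r.v k)
  growth : ∀ k, HasQuadraticGrowth (dual ω A (s.lam k) (s.yTilde f k)) (r.κ k)
  kappa_ge : ∀ k, κmin ≤ r.κ k
  tau_le : ∀ k, r.τbar k ≤ τmax

/-- The indices `j` at which the stopping test `G(z_j, v_j) ≤ ε_k` of the `k`-th inner loop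
succeeds, where `z_j = ỹ_k - λ⁽ᵏ⁾ Aᵀ v_j`. The inner loop is left at the least such index. -/
def stopSet {n m : ℕ} (s : OuterLoop n) (r : InnerLoops m) (f : E n → ℝ) (ω : E m → ℝ)
    (A : E n →L[ℝ] E m) (k : ℕ) : Set ℕ :=
  {j | gap ω A (s.lam k) (s.yTilde f k)
      (primalPoint A (s.lam k) (s.yTilde f k) (r.v k j)) (r.v k j) ≤ (s.ε k : EReal)}

/-- A call to one of the two oracles: `∇f` at a point, or `prox_{t ω⋆}` at a point. -/
inductive OracleCall (n m : ℕ) : Type where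
  | grad (y : E n) : OracleCall n m
  | prox (t : ℝ) (w : E m) : OracleCall n m

/-- The calls made in outer iteration `k` when its inner loop takes `J k` iterations, not counting
rejected line search trials: one evaluation of `∇f`, at `y_k`, and one evaluation of a proximal
operator of `ω⋆` in each inner iteration. -/
def iterationCalls {n m : ℕ} (s : OuterLoop n) (r : InnerLoops m) (f : E n → ℝ)
    (A : E n →L[ℝ] E m) (J : ℕ → ℕ) (k : ℕ) : List (OracleCall n m) :=
  OracleCall.grad (s.y k) :: (List.range (J k)).map fun j =>
    OracleCall.prox (r.τ k j)⁻¹ (innerQuery A (s.lam k) (s.yTilde f k) (r.τ k j) (r.v k j))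

/-- The total number of oracle calls made in the outer iterations `0, …, k`. -/
def totalCalls {n m : ℕ} (s : OuterLoop n) (r : InnerLoops m) (f : E n → ℝ)
    (A : E n →L[ℝ] E m) (J : ℕ → ℕ) (k : ℕ) : ℕ :=
  ((List.range (k + 1)).flatMap (iterationCalls s r f A J)).length

end IAPG

end

open IAPG

namespace IAPG

/-! ### Convex analysis -/

/-! The outer loop is controlled by the energy `(F(x_k) - F(u))/θ_k + ‖u - x°_k‖²/2` with `θ_k =
α_k² L_k`. The momentum rule makes `β_k = θ_k/θ_0`, so after division by `θ_k` the errors contribute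
a multiple of `∑ k^(-p)`, and the energy stays bounded (`energy_le`). Since `θ_k` is of order
`1/k²`, the function gap is `O(1/k²)`. For a minimizer `u` the points `x°_k` are bounded, so `x_k -
y_k = α_k (x°_k - x°_{k-1})`, and with it an explicit `ε_k`-subgradient of `F`, is `O(1/k)`.

In an inner loop, quadratic growth makes each dual step contract the distance to the minimizers by a
fixed factor (`infDist_succ_le`). The duality gap is bounded by a multiple of that distance, because
`dom ω⋆` lies in the ball of radius `K` (`gap_succ_le`). The tolerances decay only polynomially
(`le_eps`), so `J_k = O(1 + log(k+1))`, uniformly in the data.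

Outer iterations `0, …, k` thus cost `O((k+1)(1 + log(k+1)))` calls; taking `k` of order `ε^(-1/2)`
or `ε^(-1)` gives the two claims. -/

lemma nonneg_of_forall_add_mul {a b : ℝ} (h : ∀ s ∈ Set.Ioc (0 : ℝ) 1, 0 ≤ a + s * b) :
    0 ≤ a := by
  have h1 : Filter.Tendsto (fun s : ℝ => a + s * b) (nhdsWithin 0 (Set.Ioi 0)) (nhds a) := by
    have : Filter.Tendsto (fun s : ℝ => a + s * b) (nhds 0) (nhds (a + 0 * b)) :=
      Continuous.tendsto (by fun_prop) 0
    rw [zero_mul, add_zero] at this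
    exact this.mono_left nhdsWithin_le_nhds
  exact ge_of_tendsto h1 (Filter.mem_of_superset (Ioc_mem_nhdsGT one_pos) h)

/-- Carries estimates proved for every minimizer over to the distance from the set of minimizers, so
that no nearest point is needed. -/
lemma le_mul_infDist {X : Type*} [PseudoMetricSpace X] {s : Set X} (hs : s.Nonempty) {x : X}
    {b c : ℝ} (hb : 0 ≤ b) (h : ∀ y ∈ s, c ≤ b * dist x y) : c ≤ b * Metric.infDist x s := by
  have : Nonempty s := hs.to_subtype
  rw [Metric.infDist_eq_iInf, Real.mul_iInf_of_nonneg hb]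
  exact le_ciInf fun y => h y y.2

/-- The gradient inequality of a differentiable convex function. -/
lemma bregman_nonneg {n : ℕ} {f : E n → ℝ} (hf : ConvexOn ℝ Set.univ f) {y : E n}
    (hd : DifferentiableAt ℝ f y) (x : E n) : 0 ≤ bregman f x y := by
  have h1 : HasDerivAt (fun s : ℝ => f (y + s • (x - y))) ⟪∇ f y, x - y⟫ 0 := by
    have h2 : HasFDerivAt f (InnerProductSpace.toDual ℝ (E n) (∇ f y)) (y + (0 : ℝ) • (x - y)) := by
      rw [zero_smul, add_zero]
      exact hd.hasGradientAt.hasFDerivAt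
    have h3 : HasDerivAt (fun s : ℝ => y + s • (x - y)) (x - y) 0 := by
      simpa using ((hasDerivAt_id (0 : ℝ)).smul_const (x - y)).const_add y
    exact h2.comp_hasDerivAt (0 : ℝ) h3
  have h4 := (hasDerivAt_iff_tendsto_slope.1 h1).mono_left
    (nhdsWithin_mono 0 (fun s (hs : s ∈ Set.Ioi (0 : ℝ)) => ne_of_gt hs))
  have h5 : ⟪∇ f y, x - y⟫ ≤ f x - f y := by
    refine le_of_tendsto h4 (Filter.mem_of_superset (Ioc_mem_nhdsGT one_pos) ?_)
    intro s hs
    have h6 := hf.2 (Set.mem_univ x) (Set.mem_univ y) hs.1.le (sub_nonneg.2 hs.2) (by ring)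
    have h7 : s • x + (1 - s) • y = y + s • (x - y) := by module
    rw [h7] at h6
    simp only [slope_def_field, Set.mem_ofPred_eq, zero_smul, add_zero, sub_zero, smul_eq_mul]
      at h6 ⊢
    rw [div_le_iff₀ hs.1]
    linarith
  unfold bregman
  linarith

/-- Bound `f z` below from `y` and above from `x`, where `z` is a gradient step from `x` for `f -
⟨∇f y, ·⟩`; bounding `f x` from `y` removes the function values. A majorant `L' > 0` is used because
the sign of `L` is not known. -/
lemma IsConvexSmooth.norm_gradient_sub_le {n : ℕ} {f : E n → ℝ} {L L' : ℝ}
    (hf : IsConvexSmooth f L) (hL : L ≤ L') (hL' : 0 < L') (x y : E n) :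
    ‖∇ f x - ∇ f y‖ ≤ L' * ‖x - y‖ := by
  set d := ∇ f x - ∇ f y with hd
  set z := x - L'⁻¹ • d with hz
  have h1 := bregman_nonneg hf.convex (hf.differentiable y) z
  have h2 := hf.bregman_le z x
  have h3 := hf.bregman_le x y
  unfold bregman at h1 h2 h3
  have e1 : z - y = (x - y) + (z - x) := by abel
  have e2 : z - x = -(L'⁻¹ • d) := by rw [hz]; abel
  rw [e1, inner_add_right] at h1
  have e3 : ⟪∇ f x, z - x⟫ - ⟪∇ f y, z - x⟫ = -(L'⁻¹ * ‖d‖ ^ 2) := by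
    rw [← inner_sub_left, ← hd, e2, inner_neg_right, inner_smul_right,
      real_inner_self_eq_norm_sq]
  have e4 : ‖z - x‖ ^ 2 = L'⁻¹ ^ 2 * ‖d‖ ^ 2 := by
    rw [e2, norm_neg, norm_smul, mul_pow, Real.norm_eq_abs, sq_abs]
  have h4 : L / 2 * ‖z - x‖ ^ 2 ≤ L' / 2 * ‖z - x‖ ^ 2 := by gcongr
  have h5 : L / 2 * ‖x - y‖ ^ 2 ≤ L' / 2 * ‖x - y‖ ^ 2 := by gcongr
  rw [e4] at h4
  have e5 : L' / 2 * (L'⁻¹ ^ 2 * ‖d‖ ^ 2) = L'⁻¹ * ‖d‖ ^ 2 / 2 := by field_simp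
  have h6 : L'⁻¹ * ‖d‖ ^ 2 ≤ L' * ‖x - y‖ ^ 2 := by
    rw [e4] at h2
    linarith
  have h7 : ‖d‖ ^ 2 ≤ (L' * ‖x - y‖) ^ 2 := by
    rw [inv_mul_le_iff₀ hL'] at h6
    calc _ ≤ _ := h6
      _ = _ := by ring
  exact le_of_sq_le_sq h7 (by positivity)

/-! ### The conjugate of a finite function -/

section Conj

variable {m : ℕ} {ω : E m → ℝ}

lemma conj_le_coe_iff {v : E m} {c : ℝ} : conj ω v ≤ c ↔ ∀ z, ⟪z, v⟫ - ω z ≤ c := by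
  simp only [conj, conjugate, iSup_le_iff, ← EReal.coe_sub, EReal.coe_le_coe_iff]

lemma fenchel_young {v : E m} {c : ℝ} (h : conj ω v = c) (z : E m) : ⟪z, v⟫ - ω z ≤ c :=
  conj_le_coe_iff.1 h.le z

lemma conj_ne_bot (v : E m) : conj ω v ≠ ⊥ := by
  have : ((⟪(0 : E m), v⟫ - ω 0 : ℝ) : EReal) ≤ conj ω v := by
    rw [EReal.coe_sub]
    exact le_iSup (fun z : E m => ((⟪z, v⟫ : ℝ) : EReal) - (ω z : EReal)) 0
  exact ne_bot_of_le_ne_bot (EReal.coe_ne_bot _) this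

lemma exists_conj_eq_coe {v : E m} (h : conj ω v < ⊤) : ∃ c : ℝ, conj ω v = c :=
  ⟨_, (EReal.coe_toReal h.ne (conj_ne_bot v)).symm⟩

lemma conj_convex_le {v w : E m} {c d s : ℝ} (hv : conj ω v = c) (hw : conj ω w = d)
    (hs : s ∈ Set.Icc (0 : ℝ) 1) :
    conj ω (v + s • (w - v)) ≤ (c + s * (d - c) : ℝ) := by
  rw [conj_le_coe_iff]
  intro z
  have h1 := mul_le_mul_of_nonneg_left (fenchel_young hv z) (sub_nonneg.2 hs.2)
  have h2 := mul_le_mul_of_nonneg_left (fenchel_young hw z) hs.1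
  rw [inner_add_right, inner_smul_right, inner_sub_right]
  linarith

/-- Fenchel–Young at `s • v` would let `s ‖v‖ (‖v‖ - K)` stay bounded as `s → ∞`. This is why no
initial dual distance enters the constants. -/
lemma norm_le_of_conj_lt_top {K : ℝ≥0} (hω : LipschitzWith K ω) {v : E m}
    (h : conj ω v < ⊤) : ‖v‖ ≤ K := by
  obtain ⟨c, hc⟩ := exists_conj_eq_coe h
  by_contra! hlt
  have hv : 0 < ‖v‖ := lt_of_le_of_lt K.2 hlt
  have key : ∀ s : ℝ, 0 ≤ s → s * (‖v‖ * (‖v‖ - K)) ≤ c + ω 0 := by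
    intro s hs
    have h1 := fenchel_young hc (s • v)
    have h2 := (le_abs_self _).trans (hω.dist_le_mul (s • v) 0)
    rw [dist_zero_right, norm_smul, Real.norm_of_nonneg hs] at h2
    rw [inner_smul_left, real_inner_self_eq_norm_sq, conj_trivial] at h1
    nlinarith
  have hpos : 0 < ‖v‖ * (‖v‖ - K) := mul_pos hv (sub_pos.2 hlt)
  have h3 := key ((|c + ω 0| + 1) / (‖v‖ * (‖v‖ - K))) (by positivity)
  rw [div_mul_cancel₀ _ hpos.ne'] at h3
  linarith [le_abs_self (c + ω 0)]

/-- First order optimality for the sum of a conjugate and a function that is quadratic along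
lines. -/
lemma conj_le_add_of_isMin {Q : E m → ℝ} {v w : E m} {c d l b : ℝ}
    (hmin : ∀ z, conj ω v + (Q v : EReal) ≤ conj ω z + (Q z : EReal))
    (hv : conj ω v = c) (hw : conj ω w = d)
    (hQ : ∀ s : ℝ, Q (v + s • (w - v)) = Q v + s * l + s ^ 2 * b) : c ≤ d + l := by
  suffices 0 ≤ d + l - c by linarith
  refine nonneg_of_forall_add_mul (b := b) fun s hs => ?_
  have h1 := (hmin (v + s • (w - v))).trans
    (add_le_add_left (conj_convex_le hv hw ⟨hs.1.le, hs.2⟩) _)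
  rw [hv, hQ, ← EReal.coe_add, ← EReal.coe_add, EReal.coe_le_coe_iff] at h1
  have h2 : 0 ≤ s * (d + l - c + s * b) := by linarith
  exact nonneg_of_mul_nonneg_right h2 hs.1

lemma conj_lt_top_of_mem_argmin_add {Q : E m → ℝ} {v w : E m}
    (hmin : conj ω v + (Q v : EReal) ≤ conj ω w + (Q w : EReal)) (hw : conj ω w < ⊤) :
    conj ω v < ⊤ := by
  rw [lt_top_iff_ne_top]
  intro h
  obtain ⟨d, hd⟩ := exists_conj_eq_coe hw
  rw [h, hd, EReal.top_add_coe, ← EReal.coe_add, top_le_iff] at hmin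
  exact EReal.coe_ne_top _ hmin

/-- Fenchel–Moreau in the form needed here: a subgradient `x` of `ω⋆` at `v` gives equality in
Fenchel–Young. Otherwise an affine minorant of `ω`, nearly touching at `x`, has a slope `w` that
violates the subgradient inequality. -/
lemma le_inner_sub_of_forall_conj (hω : ConvexOn ℝ Set.univ ω) (hc : Continuous ω) {x v : E m}
    {c : ℝ} (h : ∀ w d, conj ω w = (d : ℝ) → c + ⟪x, w - v⟫ ≤ d) : ω x ≤ ⟪x, v⟫ - c := by
  by_contra! hlt
  obtain ⟨e, he₁, he₂⟩ := exists_between hlt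
  obtain ⟨l, b, hl, hle⟩ := hω.exists_affine_le_of_lt (𝕜 := ℝ) (Set.mem_univ x) he₂
    isClosed_univ (hc.lowerSemicontinuous.lowerSemicontinuousOn _)
  set w := (InnerProductSpace.toDual ℝ (E m)).symm l with hw
  have hlw : ∀ z, l z = ⟪z, w⟫ := fun z => by
    rw [real_inner_comm, hw, InnerProductSpace.toDual_symm_apply]
  have hconj : conj ω w ≤ (-b : ℝ) := by
    rw [conj_le_coe_iff]
    intro z
    have h1 : l z + b ≤ ω z := hl ⟨z, Set.mem_univ z⟩
    rw [hlw] at h1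
    linarith
  obtain ⟨d, hd⟩ := exists_conj_eq_coe (hconj.trans_lt (EReal.coe_lt_top _))
  have h2 := h w d hd
  rw [hd, EReal.coe_le_coe_iff] at hconj
  have h3 : l x + b = e := hle
  rw [hlw] at h3
  rw [inner_sub_right] at h2
  linarith

end Conj

/-! ### The proximal subproblem and its dual -/

section Dual

variable {n m : ℕ} {ω : E m → ℝ} {A : E n →L[ℝ] E m} {t : ℝ} {y : E n}

lemma hQuad_eq (ht : 0 < t) (u : E n) : hQuad t y u = t / 2 * ‖u‖ ^ 2 - ⟪u, y⟫ := by
  rw [hQuad, norm_sub_sq_real, norm_smul, inner_smul_left, mul_pow, Real.norm_eq_abs, sq_abs,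
    conj_trivial]
  field_simp
  ring

lemma gradient_hQuad (ht : 0 < t) (u : E n) : ∇ (hQuad t y) u = t • u - y := by
  refine HasGradientAt.gradient ?_
  rw [hasGradientAt_iff_hasFDerivAt]
  have h : hQuad t y = fun u => t / 2 * ‖u‖ ^ 2 - ⟪u, y⟫ := funext fun u => hQuad_eq ht u
  rw [h]
  have h1 := ((hasStrictFDerivAt_norm_sq u).hasFDerivAt.const_mul (t / 2)).sub
    ((hasFDerivAt_id u).inner ℝ (hasFDerivAt_const y u))
  refine h1.congr_fderiv ?_
  ext z
  simp [real_inner_comm z y]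
  ring

lemma dualSmooth_eq (ht : 0 < t) (v : E m) :
    dualSmooth A t y v = t / 2 * ‖A.adjoint v‖ ^ 2 - ⟪A.adjoint v, y⟫ := hQuad_eq ht _

lemma gradient_dualSmooth (ht : 0 < t) (v : E m) :
    ∇ (dualSmooth A t y) v = A (t • A.adjoint v - y) := by
  refine HasGradientAt.gradient ?_
  rw [hasGradientAt_iff_hasFDerivAt]
  have h : dualSmooth A t y = fun v => t / 2 * ‖A.adjoint v‖ ^ 2 - ⟪A.adjoint v, y⟫ :=
    funext fun v => dualSmooth_eq ht v
  rw [h]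
  have h0 : HasFDerivAt (fun v => A.adjoint v) A.adjoint v := A.adjoint.hasFDerivAt
  have h1 := ((h0.norm_sq).const_mul (t / 2)).sub (h0.inner ℝ (hasFDerivAt_const y v))
  refine h1.congr_fderiv ?_
  ext z
  simp [← ContinuousLinearMap.adjoint_inner_right, real_inner_comm _ y]
  ring

lemma inner_gradient_dualSmooth (ht : 0 < t) (v d : E m) :
    ⟪∇ (dualSmooth A t y) v, d⟫ = -⟪A (primalPoint A t y v), d⟫ := by
  rw [gradient_dualSmooth ht, primalPoint, ← inner_neg_left, ← map_neg, neg_sub]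

/-- Exact because the function is quadratic; it yields both convexity and the line expansion
required by `conj_le_add_of_isMin`. -/
lemma dualSmooth_add_smul (ht : 0 < t) (v d : E m) (s : ℝ) :
    dualSmooth A t y (v + s • d) = dualSmooth A t y v + s * (-⟪A (primalPoint A t y v), d⟫)
      + s ^ 2 * (t / 2 * ‖A.adjoint d‖ ^ 2) := by
  rw [dualSmooth_eq ht, dualSmooth_eq ht, primalPoint, ← A.adjoint_inner_right (_ - _) d, map_add,
    map_smul, norm_add_sq_real, norm_smul, inner_add_left, inner_smul_left, inner_smul_right,
    inner_sub_left, inner_smul_left, mul_pow, Real.norm_eq_abs, sq_abs,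
    real_inner_comm _ y]
  simp only [conj_trivial]
  ring

lemma bregman_dualSmooth_nonneg (ht : 0 < t) (v w : E m) :
    0 ≤ bregman (dualSmooth A t y) w v := by
  have h := dualSmooth_add_smul (A := A) (y := y) ht v (w - v) 1
  rw [one_smul, add_sub_cancel] at h
  rw [bregman, inner_gradient_dualSmooth ht, h]
  have : 0 ≤ t / 2 * ‖A.adjoint (w - v)‖ ^ 2 := by positivity
  linarith

lemma dual_eq_coe {v : E m} {c : ℝ} (h : conj ω v = c) :
    dual ω A t y v = (dualSmooth A t y v + c : ℝ) := by
  rw [dual, h, EReal.coe_add]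

/-- The decrease of the dual objective in a proximal gradient step with an accepted line search
constant. -/
lemma dual_step (ht : 0 < t) {τ : ℝ} (hτ : 0 < τ) {v v' w : E m} {c' d : ℝ}
    (hstep : v' ∈ prox τ⁻¹ (conj ω) (innerQuery A t y τ v))
    (hls : bregman (dualSmooth A t y) v' v ≤ τ / 2 * ‖v' - v‖ ^ 2)
    (hv' : conj ω v' = c') (hw : conj ω w = d) :
    dualSmooth A t y v' + c' + τ / 2 * ‖v' - w‖ ^ 2 ≤
      dualSmooth A t y w + d + τ / 2 * ‖v - w‖ ^ 2 := by
  set q := innerQuery A t y τ v with hq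
  -- Optimality in the proximal problem: `τ (q - v')` is a subgradient of `ω⋆` at `v'`. Adding
  -- convexity of the smooth part between `v` and `w` and the line search bound leaves a three-point
  -- identity for the norms.
  have h1 : c' ≤ d + -(τ * ⟪q - v', w - v'⟫) := by
    refine conj_le_add_of_isMin (Q := fun z => 1 / (2 * τ⁻¹) * ‖q - z‖ ^ 2) hstep hv' hw
      (b := τ / 2 * ‖w - v'‖ ^ 2) fun s => ?_
    have e : q - (v' + s • (w - v')) = (q - v') - s • (w - v') := by abel
    rw [e, norm_sub_sq_real (q - v'), norm_smul, mul_pow, Real.norm_eq_abs, sq_abs,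
      inner_smul_right]
    field_simp
    ring
  have h2 := bregman_dualSmooth_nonneg (A := A) (y := y) ht v w
  have h3 : q - v' = (v - v') - τ⁻¹ • ∇ (dualSmooth A t y) v := by
    rw [hq, innerQuery, gradient_hQuad ht, gradient_dualSmooth ht]
    abel
  rw [h3, inner_sub_left, inner_smul_left, conj_trivial] at h1
  have h4 : τ * (τ⁻¹ * ⟪∇ (dualSmooth A t y) v, w - v'⟫) = ⟪∇ (dualSmooth A t y) v, w - v'⟫ := by
    field_simp
  unfold bregman at h2 hls
  have e1 : w - v = (w - v') + (v' - v) := by abel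
  have e2 : v - w = (v - v') - (w - v') := by abel
  rw [e1, inner_add_right] at h2
  rw [norm_sub_rev v' v] at hls
  rw [norm_sub_rev v' w, e2, norm_sub_sq_real (v - v')]
  linarith

lemma conj_lt_top_of_mem_argmin_dual {v w : E m} (hv : v ∈ argmin (dual ω A t y))
    (hw : conj ω w < ⊤) : conj ω v < ⊤ := by
  have h := hv w
  simp only [dual, add_comm] at h
  exact conj_lt_top_of_mem_argmin_add h hw

/-- Strong duality: the primal point of a dual minimizer closes the duality gap. -/
lemma omega_primalPoint_add_le (hω : ConvexOn ℝ Set.univ ω) (hc : Continuous ω) (ht : 0 < t)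
    {v : E m} {c : ℝ} (hmin : v ∈ argmin (dual ω A t y)) (hv : conj ω v = c) :
    ω (A (primalPoint A t y v)) + c ≤ ⟪A (primalPoint A t y v), v⟫ := by
  have h := le_inner_sub_of_forall_conj hω hc (x := A (primalPoint A t y v)) (v := v) (c := c)
    fun w d hw => by
      have h1 : c ≤ d + -⟪A (primalPoint A t y v), w - v⟫ := by
        refine conj_le_add_of_isMin (Q := dualSmooth A t y) (fun z => ?_) hv hw
          (b := t / 2 * ‖A.adjoint (w - v)‖ ^ 2) fun s => dualSmooth_add_smul ht v (w - v) s
        have h2 := hmin z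
        simp only [dual] at h2
        rwa [add_comm, add_comm (conj ω z)]
      linarith
  linarith

/-- By strong duality at `w`, the gap is at most the primal difference between the points attached
to `v` and `w` plus the dual difference. The primal difference consists of an `ω` part, bounded by
the Lipschitz property, and a difference of squares, bounded because `v` and `w` have norm at most
`K`. Each part is at most `a² t K ‖v - w‖`. -/
lemma gap_le (hω : ConvexOn ℝ Set.univ ω) {K : ℝ≥0} (hK : LipschitzWith K ω) (ht : 0 < t)
    {a : ℝ} (ha : ‖A‖ ≤ a) {v w : E m} {c d : ℝ} (hv : conj ω v = c) (hw : conj ω w = d)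
    (hmin : w ∈ argmin (dual ω A t y)) :
    gap ω A t y (primalPoint A t y v) v ≤
      (2 * a ^ 2 * t * K * ‖v - w‖ + (dualSmooth A t y v + c - (dualSmooth A t y w + d)) : ℝ) := by
  have ha0 : 0 ≤ a := (norm_nonneg _).trans ha
  rw [gap, dual_eq_coe hv, ← EReal.coe_add, EReal.coe_le_coe_iff, primal]
  have hA : ∀ u, ‖A.adjoint u‖ ≤ a * ‖u‖ := fun u =>
    (A.adjoint.le_opNorm u).trans (by rw [LinearIsometryEquiv.norm_map]; gcongr)
  have h1 := omega_primalPoint_add_le hω hK.continuous ht hmin hw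
  have h2 := (le_abs_self _).trans
    (hK.dist_le_mul (A (primalPoint A t y v)) (A (primalPoint A t y w)))
  have h3 : dist (A (primalPoint A t y v)) (A (primalPoint A t y w)) ≤ a ^ 2 * t * ‖v - w‖ := by
    rw [dist_eq_norm, ← map_sub]
    refine (A.le_opNorm _).trans ?_
    have e : primalPoint A t y v - primalPoint A t y w = -(t • A.adjoint (v - w)) := by
      rw [primalPoint, primalPoint, map_sub]
      module
    rw [e, norm_neg, norm_smul, Real.norm_of_nonneg ht.le]
    calc ‖A‖ * (t * ‖A.adjoint (v - w)‖) ≤ a * (t * (a * ‖v - w‖)) := by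
          gcongr
          exact hA _
      _ = _ := by ring
  have h4 : ω (A (primalPoint A t y v)) - ω (A (primalPoint A t y w)) ≤
      a ^ 2 * t * K * ‖v - w‖ := by
    refine h2.trans ?_
    calc _ ≤ (K : ℝ) * (a ^ 2 * t * ‖v - w‖) := by gcongr
      _ = _ := by ring
  have hvK : ‖v‖ ≤ K := norm_le_of_conj_lt_top hK (hv ▸ EReal.coe_lt_top c)
  have hwK : ‖w‖ ≤ K := norm_le_of_conj_lt_top hK (hw ▸ EReal.coe_lt_top d)
  have h5 : ‖A.adjoint v‖ - ‖A.adjoint w‖ ≤ a * ‖v - w‖ :=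
    (norm_sub_norm_le _ _).trans (by rw [← map_sub]; exact hA _)
  have h6 : ‖A.adjoint v‖ + ‖A.adjoint w‖ ≤ 2 * a * K := by
    have h7 : ‖A.adjoint v‖ ≤ a * K := (hA v).trans (by gcongr)
    have h8 : ‖A.adjoint w‖ ≤ a * K := (hA w).trans (by gcongr)
    linarith
  have h7 : t / 2 * (‖A.adjoint v‖ ^ 2 - ‖A.adjoint w‖ ^ 2) ≤ a ^ 2 * t * K * ‖v - w‖ := by
    have h8 : ‖A.adjoint v‖ ^ 2 - ‖A.adjoint w‖ ^ 2 ≤ (a * ‖v - w‖) * (2 * a * K) := by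
      calc _ = (‖A.adjoint v‖ - ‖A.adjoint w‖) * (‖A.adjoint v‖ + ‖A.adjoint w‖) := by ring
        _ ≤ (a * ‖v - w‖) * (‖A.adjoint v‖ + ‖A.adjoint w‖) := by gcongr
        _ ≤ _ := by gcongr
    calc _ ≤ t / 2 * ((a * ‖v - w‖) * (2 * a * K)) := by gcongr
      _ = _ := by ring
  have e1 : 1 / (2 * t) * ‖primalPoint A t y v - y‖ ^ 2 = t / 2 * ‖A.adjoint v‖ ^ 2 := by
    have e : primalPoint A t y v - y = -(t • A.adjoint v) := by rw [primalPoint]; abel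
    rw [e, norm_neg, norm_smul, mul_pow, Real.norm_eq_abs, sq_abs]
    field_simp
  have e2 : ⟪A (primalPoint A t y w), w⟫ = ⟪A.adjoint w, y⟫ - t * ‖A.adjoint w‖ ^ 2 := by
    rw [← ContinuousLinearMap.adjoint_inner_right, primalPoint, inner_sub_left, inner_smul_left,
      conj_trivial, real_inner_self_eq_norm_sq, real_inner_comm]
  rw [e1, dualSmooth_eq ht w]
  rw [e2] at h1
  linarith

end Dual

/-! ### The inner loop -/

section Inner

variable {n m : ℕ} {ω : E m → ℝ} {A : E n →L[ℝ] E m} {t : ℝ} {y : E n} {τbar : ℝ} {τ : ℕ → ℝ}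
  {v : ℕ → E m}

lemma IsInnerRun.conj_lt_top (h : IsInnerRun ω A t y τbar τ v) (j : ℕ) : conj ω (v j) < ⊤ := by
  cases j with
  | zero => exact h.feasible
  | succ j =>
    exact conj_lt_top_of_mem_argmin_add
      (Q := fun z => 1 / (2 * (τ j)⁻¹) * ‖innerQuery A t y (τ j) (v j) - z‖ ^ 2)
      (h.step j _) h.feasible

lemma HasQuadraticGrowth.growth_real {κ : ℝ} (hg : HasQuadraticGrowth (dual ω A t y) κ)
    {v w : E m} {c d : ℝ} (hv : conj ω v = c) (hw : conj ω w = d)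
    (hmin : w ∈ argmin (dual ω A t y)) :
    dualSmooth A t y w + d + κ / 2 * Metric.infDist v (argmin (dual ω A t y)) ^ 2 ≤
      dualSmooth A t y v + c := by
  have h1 := hg.growth v
  have h2 : (⨅ z, dual ω A t y z) = dual ω A t y w :=
    le_antisymm (iInf_le _ w) (le_iInf hmin)
  rwa [h2, dual_eq_coe hv, dual_eq_coe hw, ← EReal.coe_add, EReal.coe_le_coe_iff] at h1

/-- Growth adds `κ/2 · D²` to the left side of `dual_step` at a minimizer, hence `(κ + τ) D² ≤ τ
‖v_j - w‖²`. The ratio `τ/(κ + τ)` increases with `τ`, so `τbar` may replace `τ`. -/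
lemma IsInnerRun.infDist_succ_le (h : IsInnerRun ω A t y τbar τ v) (ht : 0 < t) {κ : ℝ}
    (hg : HasQuadraticGrowth (dual ω A t y) κ) (j : ℕ) :
    Metric.infDist (v (j + 1)) (argmin (dual ω A t y)) ≤
      √(τbar / (κ + τbar)) * Metric.infDist (v j) (argmin (dual ω A t y)) := by
  set D := Metric.infDist (v (j + 1)) (argmin (dual ω A t y)) with hD
  have hD0 : 0 ≤ D := Metric.infDist_nonneg
  have hτ := h.tau_pos j
  have hτb : 0 < τbar := hτ.trans_le (h.tau_le j)
  have hκ := hg.pos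
  refine le_mul_infDist hg.nonempty (Real.sqrt_nonneg _) fun w hw => ?_
  obtain ⟨c, hc⟩ := exists_conj_eq_coe (h.conj_lt_top (j + 1))
  obtain ⟨d, hd⟩ := exists_conj_eq_coe (conj_lt_top_of_mem_argmin_dual hw h.feasible)
  have h1 := dual_step ht hτ (h.step j) (h.line_search j) hc hd
  have h2 := hg.growth_real hc hd hw
  have h3 : D ≤ ‖v (j + 1) - w‖ := by
    rw [← dist_eq_norm]
    exact Metric.infDist_le_dist_of_mem hw
  have h4 : D ^ 2 ≤ ‖v (j + 1) - w‖ ^ 2 := by gcongr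
  have h5 : (κ + τ j) * D ^ 2 ≤ τ j * ‖v j - w‖ ^ 2 := by
    have := mul_le_mul_of_nonneg_left h4 (half_pos hτ).le
    linarith
  have h6 : D ^ 2 ≤ τbar / (κ + τbar) * ‖v j - w‖ ^ 2 := by
    have h7 : τ j / (κ + τ j) ≤ τbar / (κ + τbar) := by
      rw [div_le_div_iff₀ (by positivity) (by positivity)]
      have := mul_le_mul_of_nonneg_left (h.tau_le j) hκ.le
      linarith
    calc D ^ 2 ≤ τ j / (κ + τ j) * ‖v j - w‖ ^ 2 := by
          rw [div_mul_eq_mul_div, le_div_iff₀ (by positivity)]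
          linarith
      _ ≤ _ := by gcongr
  rw [dist_eq_norm]
  refine le_of_sq_le_sq ?_ (by positivity)
  rwa [mul_pow, Real.sq_sqrt (by positivity)]

lemma IsInnerRun.infDist_le (h : IsInnerRun ω A t y τbar τ v) (ht : 0 < t) {κ : ℝ}
    (hg : HasQuadraticGrowth (dual ω A t y) κ) {K : ℝ≥0} (hK : LipschitzWith K ω) (j : ℕ) :
    Metric.infDist (v j) (argmin (dual ω A t y)) ≤ √(τbar / (κ + τbar)) ^ j * (2 * K) := by
  induction j with
  | zero =>
    obtain ⟨w, hw⟩ := hg.nonempty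
    refine (Metric.infDist_le_dist_of_mem hw).trans ?_
    have h1 := norm_le_of_conj_lt_top hK h.feasible
    have h2 := norm_le_of_conj_lt_top hK (conj_lt_top_of_mem_argmin_dual hw h.feasible)
    rw [dist_eq_norm, pow_zero, one_mul]
    linarith [norm_sub_le (v 0) w]
  | succ j ih =>
    refine (h.infDist_succ_le ht hg j).trans ?_
    rw [pow_succ', mul_assoc]
    gcongr

/-- Linear convergence of the duality gap in the inner loop. -/
lemma IsInnerRun.gap_succ_le (h : IsInnerRun ω A t y τbar τ v) (ht : 0 < t) {κ : ℝ}
    (hg : HasQuadraticGrowth (dual ω A t y) κ) {K : ℝ≥0} (hK : LipschitzWith K ω)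
    (hω : ConvexOn ℝ Set.univ ω) {a : ℝ} (ha : ‖A‖ ≤ a) (j : ℕ) :
    gap ω A t y (primalPoint A t y (v (j + 1))) (v (j + 1)) ≤
      ((2 * a ^ 2 * t * K + τbar * K) * (√(τbar / (κ + τbar)) ^ j * (2 * K)) : ℝ) := by
  set r := √(τbar / (κ + τbar)) with hr
  have hτ := h.tau_pos j
  have hτb : 0 < τbar := hτ.trans_le (h.tau_le j)
  have hκ := hg.pos
  have hr1 : r ≤ 1 := by
    exact Real.sqrt_le_one.2 (div_le_one_of_le₀ (by linarith) (by positivity))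
  obtain ⟨c, hc⟩ := exists_conj_eq_coe (h.conj_lt_top (j + 1))
  obtain ⟨w₀, hw₀⟩ := hg.nonempty
  obtain ⟨d₀, hd₀⟩ := exists_conj_eq_coe (conj_lt_top_of_mem_argmin_dual hw₀ h.feasible)
  -- All minimizers share one dual value, so `w₀` can fix the reference value while `w` varies in
  -- the distance bounds.
  have hval : ∀ w ∈ argmin (dual ω A t y), ∀ d : ℝ, conj ω w = d →
      dualSmooth A t y w + d = dualSmooth A t y w₀ + d₀ := by
    intro w hw d hd
    have h1 := hw w₀
    have h2 := hw₀ w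
    rw [dual_eq_coe hd, dual_eq_coe hd₀, EReal.coe_le_coe_iff] at h1 h2
    exact le_antisymm h1 h2
  -- The dual excess is bounded through the preceding step, hence the index `j + 1`. One factor of
  -- the squared distance is bounded by the diameter `2K`.
  have hdiff : dualSmooth A t y (v (j + 1)) + c - (dualSmooth A t y w₀ + d₀) ≤
      τbar * K * Metric.infDist (v j) (argmin (dual ω A t y)) := by
    refine le_mul_infDist hg.nonempty (by positivity) fun w hw => ?_
    have hwt := conj_lt_top_of_mem_argmin_dual hw h.feasible
    obtain ⟨d, hd⟩ := exists_conj_eq_coe hwt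
    rw [← hval w hw d hd, dist_eq_norm]
    have h1 := dual_step ht hτ (h.step j) (h.line_search j) hc hd
    have h2 : ‖v j - w‖ ≤ 2 * K := by
      have h3 := norm_le_of_conj_lt_top hK (h.conj_lt_top j)
      have h4 := norm_le_of_conj_lt_top hK hwt
      linarith [norm_sub_le (v j) w]
    have h3 : τ j / 2 * ‖v j - w‖ ^ 2 ≤ τbar * K * ‖v j - w‖ := by
      calc τ j / 2 * ‖v j - w‖ ^ 2 = τ j / 2 * ‖v j - w‖ * ‖v j - w‖ := by ring
        _ ≤ τbar / 2 * (2 * K) * ‖v j - w‖ := by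
            gcongr
            exact h.tau_le j
        _ = _ := by ring
    have h4 : 0 ≤ τ j / 2 * ‖v (j + 1) - w‖ ^ 2 := by positivity
    linarith
  obtain ⟨g, hgap⟩ : ∃ g : ℝ, gap ω A t y (primalPoint A t y (v (j + 1))) (v (j + 1)) = g :=
    ⟨_, by rw [gap, dual_eq_coe hc, ← EReal.coe_add]⟩
  have hgle : g - (dualSmooth A t y (v (j + 1)) + c - (dualSmooth A t y w₀ + d₀)) ≤
      2 * a ^ 2 * t * K * Metric.infDist (v (j + 1)) (argmin (dual ω A t y)) := by
    refine le_mul_infDist hg.nonempty (by positivity) fun w hw => ?_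
    obtain ⟨d, hd⟩ := exists_conj_eq_coe (conj_lt_top_of_mem_argmin_dual hw h.feasible)
    have h1 := gap_le hω hK ht ha hc hd hw
    rw [hgap, EReal.coe_le_coe_iff] at h1
    rw [← hval w hw d hd, dist_eq_norm]
    linarith
  rw [hgap, EReal.coe_le_coe_iff]
  have h1 := h.infDist_le ht hg hK j
  have h2 : Metric.infDist (v (j + 1)) (argmin (dual ω A t y)) ≤ r ^ j * (2 * K) :=
    ((h.infDist_succ_le ht hg j).trans
      (mul_le_of_le_one_left Metric.infDist_nonneg hr1)).trans h1
  have h3 := mul_le_mul_of_nonneg_left h1 (by positivity : 0 ≤ τbar * (K : ℝ))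
  have h4 := mul_le_mul_of_nonneg_left h2 (by positivity : 0 ≤ 2 * a ^ 2 * t * (K : ℝ))
  linarith

end Inner

/-! ### The outer loop -/

section Outer

variable {n : ℕ} {f g : E n → ℝ} {s : OuterLoop n} {L Lmin Lmax p E₀ : ℝ}

/-! ### Growth of the momentum sequence and decay of the tolerances. -/

/-- `θ_k = α_k² L_k`. -/
noncomputable def OuterLoop.theta (s : OuterLoop n) (k : ℕ) : ℝ := s.α k ^ 2 * s.Lk k

lemma OuterLoop.IsRun.Lk_pos (h : s.IsRun f g) (k : ℕ) : 0 < s.Lk k :=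
  add_pos_of_pos_of_nonneg (h.B_pos k) (h.rho_nonneg k)

lemma OuterLoop.IsRun.theta_pos (h : s.IsRun f g) (k : ℕ) : 0 < s.theta k :=
  mul_pos (pow_pos (h.alpha_mem k).1 2) (h.Lk_pos k)

lemma OuterLoop.IsOptimal.theta_zero (ho : s.IsOptimal Lmin Lmax p E₀) :
    s.theta 0 = s.Lk 0 := by
  rw [OuterLoop.theta, ho.alpha_zero, one_pow, one_mul]

lemma OuterLoop.IsOptimal.theta_succ (ho : s.IsOptimal Lmin Lmax p E₀) (h : s.IsRun f g)
    (k : ℕ) : s.theta (k + 1) = (1 - s.α (k + 1)) * s.theta k := by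
  rw [ho.alpha_succ k]
  exact (div_mul_cancel₀ _ (h.theta_pos k).ne').symm

/-- The momentum rule equates the two arguments of each `max`, so the product telescopes. -/
lemma OuterLoop.IsOptimal.beta_eq (ho : s.IsOptimal Lmin Lmax p E₀) (h : s.IsRun f g) (k : ℕ) :
    s.β k = s.theta k / s.theta 0 := by
  induction k with
  | zero => simp [OuterLoop.β, (h.theta_pos 0).ne']
  | succ k ih =>
    have h0 := (h.theta_pos 0).ne'
    have e : s.β (k + 1) = s.β k * max (1 - s.α (k + 1))
        (s.α (k + 1) ^ 2 * s.Lk (k + 1) / (s.α k ^ 2 * s.Lk k)) := Finset.prod_range_succ _ _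
    rw [e, ih, ← ho.alpha_succ k, max_self, ho.theta_succ h]
    field_simp

/-- With `1 - a` between `(1 - a)²` and `(1 - a/2)²`, the recursion gives `(1 - a)√w ≤ a√l ≤ (1 -
a/2)√w`; dividing by `a√l√w` gives both bounds. Thus `1/√θ_k` grows linearly. -/
lemma inv_sqrt_step {a l w : ℝ} (ha : a ∈ Set.Ioc (0 : ℝ) 1) (hl : 0 < l) (hw : 0 < w)
    (h : a ^ 2 * l = (1 - a) * w) :
    (√w)⁻¹ + (2 * √l)⁻¹ ≤ (√(a ^ 2 * l))⁻¹ ∧ (√(a ^ 2 * l))⁻¹ ≤ (√w)⁻¹ + (√l)⁻¹ := by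
  obtain ⟨ha0, ha1⟩ := ha
  have hx : √(a ^ 2 * l) = a * √l := by
    rw [Real.sqrt_mul (by positivity), Real.sqrt_sq ha0.le]
  have hl' := Real.sqrt_pos.2 hl
  have hw' := Real.sqrt_pos.2 hw
  have h2 : (a * √l) ^ 2 = (1 - a) * √w ^ 2 := by
    rw [mul_pow, Real.sq_sqrt hl.le, Real.sq_sqrt hw.le, h]
  have h3 : a * √l ≤ (1 - a / 2) * √w := by
    refine le_of_sq_le_sq ?_ (mul_nonneg (by linarith) hw'.le)
    rw [h2, mul_pow]
    gcongr
    linarith [sq_nonneg (a / 2)]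
  have h4 : (1 - a) * √w ≤ a * √l := by
    refine le_of_sq_le_sq ?_ (by positivity)
    rw [h2, mul_pow]
    gcongr
    have := mul_nonneg (sub_nonneg.2 ha1) ha0.le
    linarith
  rw [hx]
  have e1 : (a * √l)⁻¹ - ((√w)⁻¹ + (2 * √l)⁻¹) =
      ((1 - a / 2) * √w - a * √l) / (a * √l * √w) := by
    field_simp
    ring
  have e2 : ((√w)⁻¹ + (√l)⁻¹) - (a * √l)⁻¹ = (a * √l - (1 - a) * √w) / (a * √l * √w) := by
    field_simp
    ring
  constructor
  · rw [← sub_nonneg, e1]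
    exact div_nonneg (sub_nonneg.2 h3) (by positivity)
  · rw [← sub_nonneg, e2]
    exact div_nonneg (sub_nonneg.2 h4) (by positivity)

lemma OuterLoop.IsOptimal.inv_sqrt_theta_bounds (ho : s.IsOptimal Lmin Lmax p E₀)
    (h : s.IsRun f g) (hL : 0 < Lmin) (k : ℕ) :
    (k + 1) / (2 * √Lmax) ≤ (√(s.theta k))⁻¹ ∧ (√(s.theta k))⁻¹ ≤ (k + 1) / √Lmin := by
  have hlo : ∀ k, (√(s.Lk k))⁻¹ ≤ (√Lmin)⁻¹ := fun k => by
    have := Real.sqrt_pos.2 hL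
    gcongr
    exact (ho.Lk_mem k).1
  have hhi : ∀ k, (2 * √Lmax)⁻¹ ≤ (2 * √(s.Lk k))⁻¹ := fun k => by
    have := Real.sqrt_pos.2 (h.Lk_pos k)
    gcongr
    exact (ho.Lk_mem k).2
  induction k with
  | zero =>
    rw [ho.theta_zero, Nat.cast_zero, zero_add, one_div, one_div]
    refine ⟨(hhi 0).trans ?_, hlo 0⟩
    have := Real.sqrt_pos.2 (h.Lk_pos 0)
    gcongr
    linarith
  | succ k ih =>
    obtain ⟨h1, h2⟩ := inv_sqrt_step (h.alpha_mem (k + 1)) (h.Lk_pos (k + 1)) (h.theta_pos k)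
      (ho.theta_succ h k)
    have h3 := hlo (k + 1)
    have h4 := hhi (k + 1)
    rw [Nat.cast_succ]
    constructor
    · refine le_trans ?_ h1
      rw [add_div _ 1, one_div]
      linarith [ih.1]
    · refine h2.trans ?_
      rw [add_div _ 1, one_div]
      linarith [ih.2]

lemma OuterLoop.IsOptimal.sqrt_theta_le (ho : s.IsOptimal Lmin Lmax p E₀)
    (h : s.IsRun f g) (hL : 0 < Lmin) (k : ℕ) : √(s.theta k) ≤ 2 * √Lmax / (k + 1) := by
  have hx := Real.sqrt_pos.2 (h.theta_pos k)
  have hM : 0 < √Lmax := Real.sqrt_pos.2 (hL.trans_le ((ho.Lk_mem 0).1.trans (ho.Lk_mem 0).2))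
  have h1 := inv_anti₀ (by positivity) (ho.inv_sqrt_theta_bounds h hL k).1
  rwa [inv_inv, inv_div] at h1

lemma OuterLoop.IsOptimal.theta_le (ho : s.IsOptimal Lmin Lmax p E₀)
    (h : s.IsRun f g) (hL : 0 < Lmin) (k : ℕ) : s.theta k ≤ 4 * Lmax / (k + 1) ^ 2 := by
  have hM : 0 < Lmax := hL.trans_le ((ho.Lk_mem 0).1.trans (ho.Lk_mem 0).2)
  calc s.theta k = √(s.theta k) ^ 2 := (Real.sq_sqrt (h.theta_pos k).le).symm
    _ ≤ (2 * √Lmax / (k + 1)) ^ 2 := by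
        gcongr
        exact ho.sqrt_theta_le h hL k
    _ = _ := by
        rw [div_pow, mul_pow, Real.sq_sqrt hM.le]
        norm_num

lemma OuterLoop.IsOptimal.le_theta (ho : s.IsOptimal Lmin Lmax p E₀)
    (h : s.IsRun f g) (hL : 0 < Lmin) (k : ℕ) : Lmin / (k + 1) ^ 2 ≤ s.theta k := by
  have hx := Real.sqrt_pos.2 (h.theta_pos k)
  have hm := Real.sqrt_pos.2 hL
  have h1 := inv_anti₀ (by positivity) (ho.inv_sqrt_theta_bounds h hL k).2
  rw [inv_inv, inv_div] at h1
  calc Lmin / (k + 1) ^ 2 = (√Lmin / (k + 1)) ^ 2 := by rw [div_pow, Real.sq_sqrt hL.le]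
    _ ≤ √(s.theta k) ^ 2 := by gcongr
    _ = _ := Real.sq_sqrt (h.theta_pos k).le

lemma OuterLoop.IsOptimal.alpha_le (ho : s.IsOptimal Lmin Lmax p E₀)
    (h : s.IsRun f g) (hL : 0 < Lmin) (k : ℕ) :
    s.α k ≤ 2 * √Lmax / √Lmin / (k + 1) := by
  have hm := Real.sqrt_pos.2 hL
  have h1 := ho.sqrt_theta_le h hL k
  have h2 : √(s.theta k) = s.α k * √(s.Lk k) := by
    rw [OuterLoop.theta, Real.sqrt_mul (sq_nonneg _), Real.sqrt_sq (h.alpha_mem k).1.le]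
  have h3 : s.α k * √Lmin ≤ s.α k * √(s.Lk k) := by
    have := (h.alpha_mem k).1.le
    gcongr
    exact (ho.Lk_mem k).1
  rw [div_right_comm, le_div_iff₀ hm]
  linarith

/-- The exponent is `p` from the schedule plus `2` from the quadratic decay of `β_k = θ_k/θ_0`; the
`ρ` term only enlarges the tolerance. -/
lemma OuterLoop.IsOptimal.le_eps (ho : s.IsOptimal Lmin Lmax p E₀) (h : s.IsRun f g)
    (hL : 0 < Lmin) (hE : 0 < E₀) (hp : 1 < p) (k : ℕ) :
    E₀ * Lmin / Lmax / ((k : ℝ) + 1) ^ (p + 2) ≤ s.ε k := by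
  have hM : 0 < Lmax := hL.trans_le ((ho.Lk_mem 0).1.trans (ho.Lk_mem 0).2)
  rcases Nat.eq_zero_or_pos k with rfl | hk
  · rw [ho.eps_zero, Nat.cast_zero, zero_add, Real.one_rpow, div_one, div_le_iff₀ hM]
    have := (ho.Lk_mem 0).1.trans (ho.Lk_mem 0).2
    gcongr
  · have hk' : (0 : ℝ) < k := by exact_mod_cast hk
    have h1 : 0 ≤ s.ρ k * (‖s.x k - s.y k‖ ^ 2 / 2) :=
      mul_nonneg (h.rho_nonneg k) (by positivity)
    have hθ0 := h.theta_pos 0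
    have h2 : s.theta 0 ≤ Lmax := ho.theta_zero ▸ (ho.Lk_mem 0).2
    rw [ho.eps_eq k hk, ho.beta_eq h]
    calc E₀ * Lmin / Lmax / ((k : ℝ) + 1) ^ (p + 2)
        = E₀ * (Lmin / (k + 1) ^ 2 / Lmax) / ((k : ℝ) + 1) ^ p := by
          rw [Real.rpow_add (by positivity), Real.rpow_two]
          field_simp
      _ ≤ E₀ * (s.theta k / s.theta 0) / (k : ℝ) ^ p := by
          have := (h.theta_pos k).le
          gcongr
          · exact ho.le_theta h hL k
          · linarith
      _ ≤ _ := le_add_of_nonneg_right h1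

/-! ### Energy estimate for the accelerated iteration. -/

/-- The basic inequality of an inexact proximal gradient step. -/
lemma OuterLoop.IsRun.prox_grad_le (h : s.IsRun f g) (hf : IsConvexSmooth f L) (k : ℕ)
    (z : E n) :
    f (s.x k) + g (s.x k) + s.Lk k / 2 * ‖z - s.x k‖ ^ 2 ≤
      f z + g z + s.Lk k / 2 * ‖z - s.y k‖ ^ 2 +
        (s.ε k - s.ρ k * (‖s.x k - s.y k‖ ^ 2 / 2)) := by
  have h1 := h.x_step k z
  have h2 := bregman_nonneg hf.convex (hf.differentiable (s.y k)) z
  have h3 := h.line_search k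
  -- The line search uses only the `B` part of `L_k`; the remaining `ρ` part offsets the adaptive
  -- share of `ε_k`.
  have hL : s.Lk k = s.B k + s.ρ k := rfl
  unfold bregman at h2 h3
  have e1 : z - s.y k = (z - s.x k) + (s.x k - s.y k) := by abel
  have e2 : s.y k - s.x k = -(s.x k - s.y k) := by abel
  rw [inner_sub_left, inner_smul_left, conj_trivial, e2, inner_neg_left] at h1
  rw [e1, inner_add_right] at h2
  rw [e1, norm_add_sq_real, real_inner_comm]
  rw [hL] at h1 ⊢
  linarith

lemma OuterLoop.IsRun.x_eq (h : s.IsRun f g) (k : ℕ) :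
    s.x k = s.α k • s.xc k + (1 - s.α k) • s.xPrev k := by
  rw [h.xc_eq, smul_add, smul_inv_smul₀ (h.alpha_mem k).1.ne']
  module

/-- Test the basic inequality at `α u + (1 - α) x_{k-1}`: its differences from `x_k` and `y_k` are
`α (u - x°_k)` and `α (u - x°_{k-1})`, which produces the factor `θ_k = α² L_k`. -/
lemma OuterLoop.IsRun.energy_step (h : s.IsRun f g) (hf : IsConvexSmooth f L)
    (hg : ConvexOn ℝ Set.univ g) (k : ℕ) (u : E n) :
    f (s.x k) + g (s.x k) - (f u + g u) + s.theta k / 2 * ‖u - s.xc k‖ ^ 2 ≤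
      (1 - s.α k) * (f (s.xPrev k) + g (s.xPrev k) - (f u + g u)) +
        s.theta k / 2 * ‖u - s.xcPrev k‖ ^ 2 +
        (s.ε k - s.ρ k * (‖s.x k - s.y k‖ ^ 2 / 2)) := by
  obtain ⟨ha0, ha1⟩ := h.alpha_mem k
  have h1 := h.prox_grad_le hf k (s.α k • u + (1 - s.α k) • s.xPrev k)
  have h2 := (hf.convex.add hg).2 (Set.mem_univ u) (Set.mem_univ (s.xPrev k)) ha0.le
    (sub_nonneg.2 ha1) (by ring)
  simp only [Pi.add_apply, smul_eq_mul] at h2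
  have e1 : s.α k • u + (1 - s.α k) • s.xPrev k - s.x k = s.α k • (u - s.xc k) := by
    rw [h.x_eq k]
    module
  have e2 : s.α k • u + (1 - s.α k) • s.xPrev k - s.y k = s.α k • (u - s.xcPrev k) := by
    rw [h.y_eq k]
    module
  rw [e1, e2, norm_smul, norm_smul, mul_pow, mul_pow, Real.norm_eq_abs, sq_abs] at h1
  rw [OuterLoop.theta]
  linarith

/-- A bound for the energy of the accelerated outer loop. -/
noncomputable def energyBound (Lmin p E₀ D : ℝ) : ℝ :=
  D ^ 2 / 2 + E₀ / Lmin * (1 + ∑' i : ℕ, 1 / ((i + 1 : ℕ) : ℝ) ^ p)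

lemma energyBound_ge (hp : 1 < p) (hL : 0 < Lmin) (hE : 0 < E₀) (D : ℝ) (k : ℕ) :
    D ^ 2 / 2 + E₀ / Lmin * (1 + ∑ i ∈ Finset.range k, 1 / ((i + 1 : ℕ) : ℝ) ^ p) ≤
      energyBound Lmin p E₀ D := by
  unfold energyBound
  gcongr
  exact ((summable_nat_add_iff 1).2 (Real.summable_one_div_nat_rpow.2 hp)).sum_le_tsum _
    fun i _ => by positivity

lemma OuterLoop.IsOptimal.energy_le (ho : s.IsOptimal Lmin Lmax p E₀) (h : s.IsRun f g)
    (hf : IsConvexSmooth f L) (hg : ConvexOn ℝ Set.univ g) (hL : 0 < Lmin) (hE : 0 < E₀)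
    {D : ℝ} {u : E n} (hu : ‖u - s.xcInit‖ ≤ D) (k : ℕ) :
    (f (s.x k) + g (s.x k) - (f u + g u)) / s.theta k + ‖u - s.xc k‖ ^ 2 / 2 ≤
      D ^ 2 / 2 + E₀ / Lmin * (1 + ∑ i ∈ Finset.range k, 1 / ((i + 1 : ℕ) : ℝ) ^ p) := by
  have h0 : E₀ / s.theta 0 ≤ E₀ / Lmin := by
    rw [ho.theta_zero]
    gcongr
    exact (ho.Lk_mem 0).1
  induction k with
  | zero =>
    have h1 := h.energy_step hf hg 0 u
    have h2 : 0 ≤ s.ρ 0 * (‖s.x 0 - s.y 0‖ ^ 2 / 2) :=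
      mul_nonneg (h.rho_nonneg 0) (by positivity)
    have hθ := h.theta_pos 0
    -- Since `α_0 = 1`, the term with `x_{-1}` vanishes and that point never enters the bound.
    rw [ho.alpha_zero, ho.eps_zero, sub_self, zero_mul, zero_add] at h1
    have h3 : s.theta 0 / 2 * ‖u - s.xcPrev 0‖ ^ 2 ≤ s.theta 0 / 2 * D ^ 2 := by
      gcongr
      exact hu
    have h4 : (f (s.x 0) + g (s.x 0) - (f u + g u)) / s.theta 0 + ‖u - s.xc 0‖ ^ 2 / 2 ≤
        D ^ 2 / 2 + E₀ / s.theta 0 := by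
      rw [div_add' _ _ _ hθ.ne', div_le_iff₀ hθ, add_mul, div_mul_cancel₀ _ hθ.ne']
      linarith
    rw [Finset.sum_range_zero, add_zero, mul_one]
    linarith
  | succ k ih =>
    have h1 := h.energy_step hf hg (k + 1) u
    have hθ := h.theta_pos (k + 1)
    have hθ' := h.theta_pos k
    have hθ0 := h.theta_pos 0
    rw [ho.eps_eq (k + 1) (Nat.succ_pos k), ho.beta_eq h, add_sub_cancel_right] at h1
    have hx : s.xPrev (k + 1) = s.x k := rfl
    have hxc : s.xcPrev (k + 1) = s.xc k := rfl
    have h2 : 1 - s.α (k + 1) = s.theta (k + 1) / s.theta k := ho.alpha_succ k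
    -- With this ratio, dividing by `θ_{k+1}` recovers the previous energy exactly, and the error
    -- becomes `E₀/(θ_0 (k+1)^p)`.
    rw [hx, hxc, h2] at h1
    have h3 : (f (s.x (k + 1)) + g (s.x (k + 1)) - (f u + g u)) / s.theta (k + 1) +
        ‖u - s.xc (k + 1)‖ ^ 2 / 2 ≤
        (f (s.x k) + g (s.x k) - (f u + g u)) / s.theta k + ‖u - s.xc k‖ ^ 2 / 2 +
          E₀ / s.theta 0 * (1 / ((k + 1 : ℕ) : ℝ) ^ p) := by
      rw [div_add' _ _ _ hθ.ne', div_le_iff₀ hθ]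
      refine (le_of_eq (by ring)).trans (h1.trans (le_of_eq ?_))
      field_simp
    have h4 : E₀ / s.theta 0 * (1 / ((k + 1 : ℕ) : ℝ) ^ p) ≤
        E₀ / Lmin * (1 / ((k + 1 : ℕ) : ℝ) ^ p) := by gcongr
    rw [Finset.sum_range_succ]
    linarith

lemma OuterLoop.IsOptimal.suboptimality_le (ho : s.IsOptimal Lmin Lmax p E₀) (h : s.IsRun f g)
    (hf : IsConvexSmooth f L) (hg : ConvexOn ℝ Set.univ g) (hL : 0 < Lmin) (hE : 0 < E₀)
    (hp : 1 < p) {D : ℝ} {u : E n} (hu : ‖u - s.xcInit‖ ≤ D) (k : ℕ) :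
    f (s.x k) + g (s.x k) - (f u + g u) ≤
      4 * Lmax * energyBound Lmin p E₀ D / (k + 1) ^ 2 := by
  have hθ := h.theta_pos k
  have h1 := (ho.energy_le h hf hg hL hE hu k).trans (energyBound_ge hp hL hE D k)
  have h2 : (f (s.x k) + g (s.x k) - (f u + g u)) / s.theta k ≤ energyBound Lmin p E₀ D := by
    have : 0 ≤ ‖u - s.xc k‖ ^ 2 / 2 := by positivity
    linarith
  have hM : 0 ≤ energyBound Lmin p E₀ D :=
    le_trans (by positivity) (energyBound_ge hp hL hE D 0)
  rw [div_le_iff₀ hθ] at h2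
  calc _ ≤ _ := h2
    _ ≤ energyBound Lmin p E₀ D * (4 * Lmax / (k + 1) ^ 2) := by
        gcongr
        exact ho.theta_le h hL k
    _ = _ := by ring

lemma OuterLoop.IsOptimal.norm_sub_xc_le (ho : s.IsOptimal Lmin Lmax p E₀) (h : s.IsRun f g)
    (hf : IsConvexSmooth f L) (hg : ConvexOn ℝ Set.univ g) (hL : 0 < Lmin) (hE : 0 < E₀)
    (hp : 1 < p) {D : ℝ} {u : E n} (hmin : ∀ z, f u + g u ≤ f z + g z)
    (hu : ‖u - s.xcInit‖ ≤ D) (k : ℕ) :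
    ‖u - s.xc k‖ ≤ √(2 * energyBound Lmin p E₀ D) := by
  have h1 := (ho.energy_le h hf hg hL hE hu k).trans (energyBound_ge hp hL hE D k)
  have h2 : 0 ≤ (f (s.x k) + g (s.x k) - (f u + g u)) / s.theta k :=
    div_nonneg (sub_nonneg.2 (hmin _)) (h.theta_pos k).le
  exact Real.le_sqrt_of_sq_le (by linarith)

/-- `x_k` and `y_k` combine `x_{k-1}` with `x°_k` and `x°_{k-1}` using the same weights, so the
difference is `α_k = O(1/k)` times a bounded vector. -/
lemma OuterLoop.IsOptimal.norm_x_sub_y_le (ho : s.IsOptimal Lmin Lmax p E₀) (h : s.IsRun f g)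
    (hf : IsConvexSmooth f L) (hg : ConvexOn ℝ Set.univ g) (hL : 0 < Lmin) (hE : 0 < E₀)
    (hp : 1 < p) {D : ℝ} {u : E n} (hmin : ∀ z, f u + g u ≤ f z + g z)
    (hu : ‖u - s.xcInit‖ ≤ D) (k : ℕ) :
    ‖s.x k - s.y k‖ ≤
      2 * √Lmax / √Lmin / (k + 1) * (2 * √(2 * energyBound Lmin p E₀ D)) := by
  have h1 : ‖u - s.xcPrev k‖ ≤ √(2 * energyBound Lmin p E₀ D) := by
    cases k with
    | zero =>
      have h2 := energyBound_ge hp hL hE D 0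
      have h3 : 0 ≤ E₀ / Lmin * (1 + ∑ i ∈ Finset.range 0, 1 / ((i + 1 : ℕ) : ℝ) ^ p) := by
        positivity
      exact hu.trans (Real.le_sqrt_of_sq_le (by linarith))
    | succ k => exact ho.norm_sub_xc_le h hf hg hL hE hp hmin hu k
  have h2 := ho.norm_sub_xc_le h hf hg hL hE hp hmin hu k
  have e : s.x k - s.y k = s.α k • ((u - s.xcPrev k) - (u - s.xc k)) := by
    rw [h.x_eq k, h.y_eq k]
    module
  rw [e, norm_smul, Real.norm_of_nonneg (h.alpha_mem k).1.le]
  have h3 := norm_sub_le (u - s.xcPrev k) (u - s.xc k)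
  gcongr
  · exact ho.alpha_le h hL k
  · linarith

/-! ### The near-stationarity certificate. -/

lemma OuterLoop.IsRun.residual_mem (h : s.IsRun f g) (hf : IsConvexSmooth f L) (k : ℕ) :
    s.Lk k • (s.y k - s.x k) - ∇ f (s.y k) + ∇ f (s.x k) ∈
      epsSubdiff (fun u => f u + g u) (s.ε k) (s.x k) := by
  intro z
  have h1 := h.x_step k z
  have h2 := bregman_nonneg hf.convex (hf.differentiable (s.x k)) z
  rw [bregman] at h2
  rw [inner_add_left]
  linarith

lemma OuterLoop.IsOptimal.norm_residual_le (ho : s.IsOptimal Lmin Lmax p E₀) (h : s.IsRun f g)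
    (hf : IsConvexSmooth f L) {L' : ℝ} (hLL : L ≤ L') (hL' : 0 < L') (k : ℕ) :
    ‖s.Lk k • (s.y k - s.x k) - ∇ f (s.y k) + ∇ f (s.x k)‖ ≤
      (Lmax + L') * ‖s.x k - s.y k‖ := by
  have h1 := hf.norm_gradient_sub_le hLL hL' (s.x k) (s.y k)
  have e : s.Lk k • (s.y k - s.x k) - ∇ f (s.y k) + ∇ f (s.x k) =
      s.Lk k • (s.y k - s.x k) + (∇ f (s.x k) - ∇ f (s.y k)) := by abel
  rw [e, add_mul]
  refine (norm_add_le _ _).trans (add_le_add ?_ h1)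
  rw [norm_smul, norm_sub_rev, Real.norm_of_nonneg (h.Lk_pos k).le]
  gcongr
  exact (ho.Lk_mem k).2

end Outer

/-! ### Counting the oracle calls -/

/-- Take logarithms and solve for `j`. The `2` in `j + 2` covers the index shift in `gap_succ_le`
and the gradient call of the outer iteration. -/
lemma exists_geometric_le {G e q r : ℝ} (hG : 0 < G) (he : 0 < e) (hq : 0 ≤ q) (hr : 0 < r)
    (hr1 : r < 1) :
    ∃ c : ℝ, 0 < c ∧ ∀ k : ℕ, ∃ j : ℕ, G * r ^ j ≤ e / ((k : ℝ) + 1) ^ q ∧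
      (j : ℝ) + 2 ≤ c * (1 + Real.log (k + 1)) := by
  have hl : 0 < -Real.log r := neg_pos.2 (Real.log_neg hr hr1)
  refine ⟨3 + (|Real.log (G / e)| + q) / (-Real.log r), by positivity, fun k => ?_⟩
  have hk : (0 : ℝ) < k + 1 := by positivity
  have hlk : 0 ≤ Real.log ((k : ℝ) + 1) :=
    Real.log_nonneg (le_add_of_nonneg_left (Nat.cast_nonneg k))
  set b := (|Real.log (G / e)| + q * Real.log (k + 1)) / (-Real.log r) with hb
  have hb0 : 0 ≤ b := by positivity
  refine ⟨⌈b⌉₊, ?_, ?_⟩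
  · have h1 : |Real.log (G / e)| + q * Real.log (k + 1) ≤ ⌈b⌉₊ * (-Real.log r) := by
      rw [← div_le_iff₀ hl]
      exact Nat.le_ceil b
    have h2 := le_abs_self (Real.log (G / e))
    rw [Real.log_div hG.ne' he.ne'] at h1 h2
    rw [← Real.log_le_log_iff (by positivity) (by positivity), Real.log_mul hG.ne' (by positivity),
      Real.log_div he.ne' (by positivity), Real.log_pow, Real.log_rpow hk]
    linarith
  · have h1 := (Nat.ceil_lt_add_one hb0).le
    have h2 : b ≤ (|Real.log (G / e)| + q) / (-Real.log r) * (1 + Real.log (k + 1)) := by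
      rw [hb, div_mul_eq_mul_div]
      gcongr
      have := mul_nonneg (abs_nonneg (Real.log (G / e))) hlk
      linarith
    linarith

/-- The witness is `⌈R ε^(-σ)⌉`. The restriction `ε ≤ exp(-1)` gives `log ε⁻¹ ≥ 1`, so additive
constants are absorbed into the logarithm. -/
lemma exists_iteration_count {c R σ : ℝ} (hc : 0 < c) (hR : 0 < R) (hσ : 0 < σ) :
    ∃ C : ℝ, 0 < C ∧ ∀ ε : ℝ, 0 < ε → ε ≤ Real.exp (-1) → ∃ k : ℕ,
      R * ε ^ (-σ) ≤ (k : ℝ) + 1 ∧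
      ((k : ℝ) + 1) * (c * (1 + Real.log (k + 1))) ≤ C * (ε ^ (-σ) * Real.log ε⁻¹) := by
  have hl : 0 ≤ Real.log (R + 2) := Real.log_nonneg (by linarith)
  refine ⟨c * (R + 2) * (1 + Real.log (R + 2) + σ), by positivity, fun ε hε hε' => ?_⟩
  have h1 : 1 ≤ Real.log ε⁻¹ := by
    rw [Real.log_inv]
    have := (Real.log_le_iff_le_exp hε).2 hε'
    linarith
  have h2 : 1 ≤ ε ^ (-σ) := by
    refine Real.one_le_rpow_of_pos_of_le_one_of_nonpos hε (hε'.trans ?_) (by linarith)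
    exact Real.exp_le_one_iff.2 (by norm_num)
  have h3 : (⌈R * ε ^ (-σ)⌉₊ : ℝ) + 1 ≤ (R + 2) * ε ^ (-σ) := by
    have := (Nat.ceil_lt_add_one (by positivity : 0 ≤ R * ε ^ (-σ))).le
    linarith
  refine ⟨⌈R * ε ^ (-σ)⌉₊, (Nat.le_ceil _).trans (le_add_of_nonneg_right zero_le_one), ?_⟩
  have h4 : Real.log ((⌈R * ε ^ (-σ)⌉₊ : ℝ) + 1) ≤ Real.log (R + 2) + σ * Real.log ε⁻¹ := by
    refine (Real.log_le_log (by positivity) h3).trans ?_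
    rw [Real.log_mul (by positivity) (by positivity), Real.log_rpow hε, Real.log_inv]
    linarith
  have h5 : 1 + Real.log ((⌈R * ε ^ (-σ)⌉₊ : ℝ) + 1) ≤
      (1 + Real.log (R + 2) + σ) * Real.log ε⁻¹ := by
    have := mul_le_mul_of_nonneg_left h1 hl
    linarith
  calc _ ≤ (R + 2) * ε ^ (-σ) * (c * ((1 + Real.log (R + 2) + σ) * Real.log ε⁻¹)) := by
        have : 0 ≤ Real.log ((⌈R * ε ^ (-σ)⌉₊ : ℝ) + 1) :=
          Real.log_nonneg (le_add_of_nonneg_left (Nat.cast_nonneg _))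
        gcongr
    _ = _ := by ring

lemma totalCalls_le {n m : ℕ} (s : OuterLoop n) (r : InnerLoops m) (f : E n → ℝ)
    (A : E n →L[ℝ] E m) {J : ℕ → ℕ} {c : ℝ} (hc : 0 ≤ c)
    (hJ : ∀ k, (J k : ℝ) + 1 ≤ c * (1 + Real.log (k + 1))) (k : ℕ) :
    (totalCalls s r f A J k : ℝ) ≤ ((k : ℝ) + 1) * (c * (1 + Real.log (k + 1))) := by
  have h1 : totalCalls s r f A J k = ∑ l ∈ Finset.range (k + 1), (J l + 1) := by
    simp only [totalCalls, iterationCalls, List.length_flatMap, List.length_cons, List.length_map,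
      List.length_range]
    rfl
  rw [h1, Nat.cast_sum]
  refine (Finset.sum_le_card_nsmul _ _ (c * (1 + Real.log (k + 1))) fun l hl => ?_).trans_eq ?_
  · rw [Nat.cast_add_one]
    refine (hJ l).trans ?_
    have : (l : ℝ) ≤ k := by exact_mod_cast Finset.mem_range_succ_iff.1 hl
    gcongr
  · rw [Finset.card_range, nsmul_eq_mul, Nat.cast_add_one]

/-- Every inner loop stops, after a number of iterations that is logarithmic in the index of the
outer iteration, with a constant that depends only on the given bounds. -/
lemma exists_inner_count (K : ℝ≥0) {Lmin Lmax p E₀ κmin τmax a : ℝ} (hLmin : 0 < Lmin)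
    (hLmax : Lmin ≤ Lmax) (hp : 1 < p) (hE₀ : 0 < E₀) (hκmin : 0 < κmin) (hτmax : 0 < τmax) :
    ∃ c : ℝ, 0 < c ∧ ∀ (n m : ℕ) (f : E n → ℝ) (ω : E m → ℝ) (A : E n →L[ℝ] E m)
      (s : OuterLoop n) (r : InnerLoops m), ConvexOn ℝ Set.univ ω → LipschitzWith K ω → ‖A‖ ≤ a →
      s.IsRun f (fun u => ω (A u)) → s.IsOptimal Lmin Lmax p E₀ → r.IsRun s f ω A κmin τmax →
      ∃ J : ℕ → ℕ, (∀ k, IsLeast (stopSet s r f ω A k) (J k)) ∧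
        ∀ k, (J k : ℝ) + 1 ≤ c * (1 + Real.log (k + 1)) := by
  have hM : 0 < Lmax := hLmin.trans_le hLmax
  set q := √(τmax / (κmin + τmax)) with hq
  -- The added `1` keeps `G` positive even if `K = 0`.
  set G := (2 * a ^ 2 * Lmin⁻¹ * K + τmax * K) * (2 * K) + 1 with hG
  have hq0 : 0 < q := Real.sqrt_pos.2 (by positivity)
  have hq1 : q < 1 := by
    rw [hq, Real.sqrt_lt' one_pos, one_pow, div_lt_one (by positivity)]
    linarith
  obtain ⟨c, hc, hcount⟩ := exists_geometric_le (G := G) (e := E₀ * Lmin / Lmax) (q := p + 2)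
    (by positivity) (by positivity) (by linarith) hq0 hq1
  refine ⟨c, hc, fun n m f ω A s r hω hK ha hs ho hr => ?_⟩
  have exists_mem : ∀ k, ∃ j : ℕ, j ∈ stopSet s r f ω A k ∧
      (j : ℝ) + 1 ≤ c * (1 + Real.log (k + 1)) := by
    intro k
    obtain ⟨j, hj1, hj2⟩ := hcount k
    refine ⟨j + 1, ?_, by push_cast; linarith⟩
    have hL := hs.Lk_pos k
    have hlam : 0 < s.lam k := inv_pos.2 hL
    have hlam' : s.lam k ≤ Lmin⁻¹ := inv_anti₀ hLmin (ho.Lk_mem k).1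
    refine ((hr.run k).gap_succ_le hlam (hr.growth k) hK hω ha j).trans ?_
    rw [EReal.coe_le_coe_iff]
    refine le_trans ?_ (hj1.trans (ho.le_eps hs hLmin hE₀ hp k))
    have hκ := (hr.growth k).pos
    have hτb : 0 < r.τbar k := ((hr.run k).tau_pos 0).trans_le ((hr.run k).tau_le 0)
    have hτ := hr.tau_le k
    -- The rate increases with `τ` and decreases with `κ`, so `τmax` and `κmin` give the uniform
    -- worst case.
    have hrate : √(r.τbar k / (r.κ k + r.τbar k)) ≤ q := by
      refine Real.sqrt_le_sqrt ?_
      rw [div_le_div_iff₀ (by positivity) (by positivity)]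
      have := mul_le_mul hτ (hr.kappa_ge k) hκmin.le hτmax.le
      linarith
    calc _ ≤ (2 * a ^ 2 * Lmin⁻¹ * K + τmax * K) * (q ^ j * (2 * K)) := by gcongr
      _ ≤ G * q ^ j := by
        rw [hG]
        have := pow_pos hq0 j
        linarith
  classical
  have hne : ∀ k, ∃ j, j ∈ stopSet s r f ω A k := fun k => (exists_mem k).imp fun j h => h.1
  refine ⟨fun k => Nat.find (hne k), fun k => ⟨Nat.find_spec (hne k), fun j hj =>
    Nat.find_min' (hne k) hj⟩, fun k => ?_⟩
  obtain ⟨j, hj1, hj2⟩ := exists_mem k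
  have h1 : (Nat.find (hne k) : ℝ) ≤ j := by exact_mod_cast Nat.find_min' (hne k) hj1
  linarith

end IAPG

theorem mainTheorem2
    (L Lmin Lmax p E₀ κmin τmax a D : ℝ) (K : ℝ≥0)
    (hLmin : 0 < Lmin) (hLmax : Lmin ≤ Lmax) (hp : 1 < p) (hE₀ : 0 < E₀)
    (hκmin : 0 < κmin) (hτmax : 0 < τmax) :
    ∃ C ε₀ : ℝ, 0 < C ∧ 0 < ε₀ ∧
      ∀ (n m : ℕ) (f : E n → ℝ) (ω : E m → ℝ) (A : E n →L[ℝ] E m)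
        (s : OuterLoop n) (r : InnerLoops m) (xbar : E n),
        IsConvexSmooth f L →
        ConvexOn ℝ Set.univ ω → LipschitzWith K ω → ‖A‖ ≤ a →
        s.IsRun f (fun u => ω (A u)) →
        s.IsOptimal Lmin Lmax p E₀ →
        r.IsRun s f ω A κmin τmax →
        (∀ u, f xbar + ω (A xbar) ≤ f u + ω (A u)) →
        ‖xbar - s.xcInit‖ ≤ D →
        ∃ J : ℕ → ℕ,
          (∀ k, IsLeast (stopSet s r f ω A k) (J k)) ∧
          (∀ ε : ℝ, 0 < ε → ε ≤ ε₀ → ∃ k : ℕ,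
            (f (s.x k) + ω (A (s.x k))) - (f xbar + ω (A xbar)) ≤ ε ∧
            (totalCalls s r f A J k : ℝ) ≤ C * (ε ^ (-(1 / 2) : ℝ) * Real.log ε⁻¹)) ∧
          (∀ ε : ℝ, 0 < ε → ε ≤ ε₀ → ∃ k : ℕ,
            (epsSubdiff (fun u => f u + ω (A u)) (s.ε k) (s.x k)).Nonempty ∧
            Metric.infDist 0 (epsSubdiff (fun u => f u + ω (A u)) (s.ε k) (s.x k)) ≤ ε ∧
            (totalCalls s r f A J k : ℝ) ≤ C * (ε⁻¹ * Real.log ε⁻¹)) := by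
  have hM : 0 < Lmax := hLmin.trans_le hLmax
  obtain ⟨c, hc, hinner⟩ := exists_inner_count K (a := a) hLmin hLmax hp hE₀ hκmin hτmax
  set M := energyBound Lmin p E₀ D with hMdef
  have hM0 : 0 ≤ M := le_trans (by positivity) (energyBound_ge hp hLmin hE₀ D 0)
  set L' := max L 1 with hLdef
  have hL' : 0 < L' := lt_max_of_lt_right one_pos
  set R₂ := (Lmax + L') * (2 * √Lmax / √Lmin * (2 * √(2 * M))) with hR₂
  -- With `T = 4 Lmax M`, the choice `R = T + 1` suffices since `(T + 1)² ≥ T`; no square root of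
  -- `T` is needed.
  obtain ⟨C₁, hC₁, hcount₁⟩ := exists_iteration_count (R := 4 * Lmax * M + 1) (σ := 1 / 2) hc
    (by positivity) (by norm_num)
  obtain ⟨C₂, hC₂, hcount₂⟩ := exists_iteration_count (R := R₂ + 1) (σ := 1) hc
    (by positivity) one_pos
  refine ⟨C₁ + C₂, Real.exp (-1), by positivity, Real.exp_pos _, ?_⟩
  intro n m f ω A s r xbar hf hω hK ha hs ho hr hmin hD
  have hg : ConvexOn ℝ Set.univ fun u => ω (A u) := hω.comp_linearMap A.toLinearMap
  obtain ⟨J, hJ, hJle⟩ := hinner n m f ω A s r hω hK ha hs ho hr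
  have hlog : ∀ ε : ℝ, 0 < ε → ε ≤ Real.exp (-1) → 0 ≤ Real.log ε⁻¹ := fun ε hε hε' =>
    Real.log_nonneg ((one_le_inv₀ hε).2 (hε'.trans (Real.exp_le_one_iff.2 (by norm_num))))
  refine ⟨J, hJ, fun ε hε hε' => ?_, fun ε hε hε' => ?_⟩
  · obtain ⟨k, hk1, hk2⟩ := hcount₁ ε hε hε'
    refine ⟨k, ?_, (totalCalls_le s r f A hc.le hJle k).trans (hk2.trans ?_)⟩
    · refine (ho.suboptimality_le hs hf hg hLmin hE₀ hp hD k).trans ?_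
      rw [div_le_iff₀ (by positivity)]
      have h1 : ((4 * Lmax * M + 1) * ε ^ (-(1 / 2) : ℝ)) ^ 2 ≤ ((k : ℝ) + 1) ^ 2 := by gcongr
      have h2 : (ε ^ (-(1 / 2) : ℝ)) ^ 2 = ε⁻¹ := by
        rw [← Real.rpow_natCast, ← Real.rpow_mul hε.le, ← Real.rpow_neg_one]
        norm_num
      rw [mul_pow, h2, ← div_eq_mul_inv, div_le_iff₀ hε] at h1
      have h3 : 0 ≤ 4 * Lmax * M := by positivity
      linarith [sq_nonneg (4 * Lmax * M)]
    · have := mul_nonneg (Real.rpow_nonneg hε.le (-(1 / 2))) (hlog ε hε hε')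
      gcongr
      linarith
  · obtain ⟨k, hk1, hk2⟩ := hcount₂ ε hε hε'
    rw [Real.rpow_neg_one] at hk1 hk2
    have hmem := hs.residual_mem hf k
    refine ⟨k, ⟨_, hmem⟩, ?_, (totalCalls_le s r f A hc.le hJle k).trans (hk2.trans ?_)⟩
    · refine (Metric.infDist_le_dist_of_mem hmem).trans ?_
      rw [dist_zero_left]
      refine (ho.norm_residual_le hs hf (le_max_left L 1) hL' k).trans ?_
      have h1 := ho.norm_x_sub_y_le hs hf hg hLmin hE₀ hp hmin hD k
      calc _ ≤ (Lmax + L') * (2 * √Lmax / √Lmin / (k + 1) * (2 * √(2 * M))) := by gcongr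
        _ = R₂ / (k + 1) := by rw [hR₂]; ring
        _ ≤ ε := by
          rw [div_le_iff₀ (by positivity)]
          rw [← div_eq_mul_inv, div_le_iff₀ hε] at hk1
          linarith
    · have := mul_nonneg (inv_pos.2 hε).le (hlog ε hε hε')
      gcongr
      linarith
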